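/- Let $\mathcal H$ be a separable complex Hilbert space, $N\ge 0$, let $H_0$ be a (possibly unbounded) selfadjoint operator on $\mathcal H$ with pure point spectrum, i.e. whose eigenvectors span a dense subspace of $\mathcal H$ (equivalently, $\mathcal H$ has an orthonormal basis of eigenvectors of $H_0$), and let $H_1,\dots,H_N$ be bounded selfadjoint operators on $\mathcal H$. For $\mathbf y=(y_1,\dots,y_N)\in\mathbb R^N$ let $H(\mathbf y)=H_0+\sum_{j=1}^N y_jH_j$, which is selfadjoint on the domain of $H_0$. Equip the unitary group $\mathrm U(\mathcal H)$ with the strong operator topology. Let the strongly reachable set $\mathcal R$ be the strong closure in $\mathrm U(\mathcal H)$ of the smallest subsemigroup of $\mathrm U(\mathcal H)$ containing all $\exp(i\tau H(\mathbf y))$ with $\tau>0$ and $\mathbf y\in\mathbb R^N$, and let the dynamical group $\mathcal G$ be the smallest strongly closed subgroup of $\mathrm U(\mathcal H)$ containing all $\exp(i\tau H(\mathbf y))$ with $\tau\in\mathbb R$ and $\mathbf y\in\mathbb R^N$. Then $\mathcal R=\mathcal G$. -/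

import Mathlib

open scoped Topology

namespace QuantumControl

section

variable {H : Type*} [NormedAddCommGroup H] [InnerProductSpace ℂ H]

/-- A (partially defined) operator is bounded on its domain. A bounded operator that is
selfadjoint is automatically defined on the whole Hilbert space. -/
def IsBoundedOperator (A : H →ₗ.[ℂ] H) : Prop :=
  ∃ C : ℝ, ∀ ψ : A.domain, ‖A ψ‖ ≤ C * ‖(ψ : H)‖

/-- The set of all vectors `ψ` in the domain of `A` with `A ψ = μ ψ` for some scalar `μ`. -/
def eigenvectors (A : H →ₗ.[ℂ] H) : Set H :=
  {ψ | ∃ μ : ℂ, (ψ, μ • ψ) ∈ A.graph}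

/-- `A` has pure point spectrum: its eigenvectors are total in the Hilbert space (for a
selfadjoint operator: there is an orthonormal basis of eigenvectors). The eigenvalues need
neither be isolated nor of finite multiplicity. -/
def HasPurePointSpectrum (A : H →ₗ.[ℂ] H) : Prop :=
  (Submodule.span ℂ (eigenvectors A)).topologicalClosure = ⊤

/-- The operator `H(y) = H₀ + ∑ j, y j • H j`, `y ∈ ℝ^N`, on the intersection of the domains
of all the `H₀, H 1, …, H N`. -/
noncomputable def hamiltonian {N : ℕ} (H₀ : H →ₗ.[ℂ] H) (Hc : Fin N → (H →ₗ.[ℂ] H))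
    (y : Fin N → ℝ) : H →ₗ.[ℂ] H :=
  H₀ + ∑ j, ((y j : ℝ) : ℂ) • Hc j

variable [CompleteSpace H]

/-- `U` is the one-parameter group `t ↦ exp (i t A)`: a strongly continuous one-parameter group
of unitaries whose generator (the operator `ψ ↦ -i d/dt U(t) ψ` at `t = 0`, defined on all `ψ`
for which this derivative exists) is exactly `A`. By Stone's theorem each selfadjoint `A` has
exactly one such group. -/
structure IsExpGroup (A : H →ₗ.[ℂ] H) (U : ℝ → unitary (H →L[ℂ] H)) : Prop where
  map_zero : U 0 = 1
  map_add : ∀ s t : ℝ, U (s + t) = U s * U t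
  strongly_continuous : ∀ ψ : H, Continuous fun t : ℝ => (U t : H →L[ℂ] H) ψ
  generator : ∀ ψ φ : H, (ψ, φ) ∈ A.graph ↔
    HasDerivAt (fun t : ℝ => (U t : H →L[ℂ] H) ψ) (Complex.I • φ) 0

/-- The strong topology on the unitary group: pointwise convergence on vectors. -/
@[reducible]
def strongTopology (H : Type*) [NormedAddCommGroup H] [InnerProductSpace ℂ H]
    [CompleteSpace H] : TopologicalSpace (unitary (H →L[ℂ] H)) :=
  TopologicalSpace.induced (fun (u : unitary (H →L[ℂ] H)) (ψ : H) => (u : H →L[ℂ] H) ψ)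
    Pi.topologicalSpace

/-- All unitaries `exp (i τ H(y))` with `τ ∈ T` and `y ∈ ℝ^N`, where `H(y)` stands for the
selfadjoint closure of the essentially selfadjoint operator `hamiltonian H₀ Hc y`. -/
def evolutions {N : ℕ} (H₀ : H →ₗ.[ℂ] H) (Hc : Fin N → (H →ₗ.[ℂ] H)) (T : Set ℝ) :
    Set (unitary (H →L[ℂ] H)) :=
  {u | ∃ (y : Fin N → ℝ) (U : ℝ → unitary (H →L[ℂ] H)),
    IsExpGroup (hamiltonian H₀ Hc y).closure U ∧ ∃ τ ∈ T, u = U τ}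

/-- The algebraically reachable set: the smallest subsemigroup of the unitary group containing
all `exp (i τ H(y))` with `τ > 0`, `y ∈ ℝ^N`. -/
noncomputable def algReachableSet {N : ℕ} (H₀ : H →ₗ.[ℂ] H) (Hc : Fin N → (H →ₗ.[ℂ] H)) :
    Subsemigroup (unitary (H →L[ℂ] H)) :=
  Subsemigroup.closure (evolutions H₀ Hc (Set.Ioi 0))

/-- The strongly reachable set: the strong closure, in the unitary group, of the algebraically
reachable set. -/
def stronglyReachableSet {N : ℕ} (H₀ : H →ₗ.[ℂ] H) (Hc : Fin N → (H →ₗ.[ℂ] H)) :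
    Set (unitary (H →L[ℂ] H)) :=
  closure[strongTopology H] (algReachableSet H₀ Hc : Set (unitary (H →L[ℂ] H)))

/-- The dynamical group: the smallest strongly closed subgroup of the unitary group containing
all `exp (i τ H(y))` with `τ ∈ ℝ`, `y ∈ ℝ^N`. -/
noncomputable def dynamicalGroup {N : ℕ} (H₀ : H →ₗ.[ℂ] H) (Hc : Fin N → (H →ₗ.[ℂ] H)) :
    Subgroup (unitary (H →L[ℂ] H)) :=
  sInf {K : Subgroup (unitary (H →L[ℂ] H)) |
    IsClosed[strongTopology H] (K : Set (unitary (H →L[ℂ] H))) ∧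
      evolutions H₀ Hc Set.univ ⊆ (K : Set (unitary (H →L[ℂ] H)))}

end

end QuantumControl

/-! The only point is that the reachable set is closed under inverses; it is then a closed group that
contains every `exp (i τ H(y))` with `τ` of either sign, and minimality gives both inclusions. As the
unitary group is a topological group in the strong topology, it is enough to reach the inverse
`exp (-i τ H(y))`, `τ > 0`, of each generator of the semigroup (`exists_subgroup_eq_closure`).

For `y = 0` this is recurrence. Since `H₀` has pure point spectrum, `t ↦ exp (i t H₀)` factors
through the diagonal unitaries for the eigenspace decomposition, a strongly continuous image of the
torus `ℝ → Circle`. The torus is compact, so inverses there are limits of positive powers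
(`exists_isExpGroup_recurrent`).

For general `y`, write `V = ∑ j, y j • H j`. Then `-(H₀ + V) = -2 H₀ + (H₀ - V)`, and the product
formula
`exp (-i τ (H₀ + V)) = lim (exp (-2 i (τ / n) H₀) * exp (i (τ / n) (H₀ - V))) ^ n`
(`IsExpGroup.tendsto_splitting`) uses only the backward evolution of `H₀`, already reached, and the
forward evolution of `H₀ - V = H(-y)`. It is proved by comparing interaction pictures with the mean
value inequality, uniformly along a compact orbit.

Evolutions are described by `IsExpGroup`, so the groups of `H₀` and of `H(-y)` have to be shown to
exist. The first is the diagonal group above (`isExpGroup_of_eigenspace`); the second comes from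
the Dyson series of the interaction picture (`IsExpGroup.exists_perturbation`). -/

namespace QuantumControl

/-! ### Unitary groups and the interaction picture -/

section

variable {H : Type*} [NormedAddCommGroup H] [InnerProductSpace ℂ H]

/-- `V +ᵥ A` is the sum of the everywhere defined `V` and of `A`, on the domain of `A`. -/
theorem mem_graph_vadd_iff {A : H →ₗ.[ℂ] H} {V : H →ₗ[ℂ] H} {ψ φ : H} :
    (ψ, φ) ∈ (V +ᵥ A).graph ↔ (ψ, φ - V ψ) ∈ A.graph := by
  simp only [LinearPMap.mem_graph_iff]
  constructor
  · rintro ⟨x, rfl, rfl⟩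
    exact ⟨x, rfl, by simp [LinearPMap.vadd_apply]⟩
  · rintro ⟨x, rfl, hx⟩
    exact ⟨x, rfl, by simp [LinearPMap.vadd_apply, hx]⟩

variable [CompleteSpace H]

theorem unitary_dist_apply (u : unitary (H →L[ℂ] H)) (x y : H) :
    dist ((u : H →L[ℂ] H) x) ((u : H →L[ℂ] H) y) = dist x y := by
  rw [dist_eq_norm, ← map_sub, Unitary.norm_map, dist_eq_norm]

theorem tendsto_unitary_apply {α : Type*} {l : Filter α} {u : α → unitary (H →L[ℂ] H)}
    {x : α → H} {y z : H} (hu : Filter.Tendsto (fun a => (u a : H →L[ℂ] H) y) l (𝓝 z))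
    (hx : Filter.Tendsto x l (𝓝 y)) :
    Filter.Tendsto (fun a => (u a : H →L[ℂ] H) (x a)) l (𝓝 z) := by
  rw [tendsto_iff_dist_tendsto_zero] at hu hx ⊢
  refine squeeze_zero (fun _ => dist_nonneg) (fun a => ?_) (by simpa using hx.add hu)
  calc _ ≤ _ := dist_triangle _ ((u a : H →L[ℂ] H) y) _
    _ = _ := by rw [unitary_dist_apply]

/-- Strong convergence of unitaries may be tested on a dense set, by equicontinuity. -/
theorem tendsto_unitary_apply_of_dense {α : Type*} {l : Filter α} {u : α → unitary (H →L[ℂ] H)}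
    {v : unitary (H →L[ℂ] H)} {S : Set H} (hS : Dense S)
    (h : ∀ ψ ∈ S, Filter.Tendsto (fun a => (u a : H →L[ℂ] H) ψ) l (𝓝 ((v : H →L[ℂ] H) ψ)))
    (ψ : H) : Filter.Tendsto (fun a => (u a : H →L[ℂ] H) ψ) l (𝓝 ((v : H →L[ℂ] H) ψ)) := by
  rw [Metric.tendsto_nhds]
  intro ε hε
  obtain ⟨φ, hφS, hφ⟩ := hS.exists_dist_lt ψ (show 0 < ε / 3 by positivity)
  filter_upwards [Metric.tendsto_nhds.1 (h φ hφS) (ε / 3) (by positivity)] with a ha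
  calc _ ≤ _ := dist_triangle4 _ ((u a : H →L[ℂ] H) φ) ((v : H →L[ℂ] H) φ) _
    _ < ε / 3 + ε / 3 + ε / 3 := by
      rw [unitary_dist_apply, unitary_dist_apply, dist_comm φ ψ]
      gcongr
    _ = ε := by ring

theorem continuous_unitary_apply {X : Type*} [TopologicalSpace X] {u : X → unitary (H →L[ℂ] H)}
    {x : X → H} (hu : ∀ ψ : H, Continuous fun a => (u a : H →L[ℂ] H) ψ) (hx : Continuous x) :
    Continuous fun a => (u a : H →L[ℂ] H) (x a) :=
  continuous_iff_continuousAt.2 fun a =>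
    tendsto_unitary_apply (hu (x a)).continuousAt hx.continuousAt

/-- Product rule for a strongly continuous family of unitaries applied to a moving vector. The
family itself only has to be differentiable on the vector reached at time `t₀`. -/
theorem hasDerivAt_unitary_apply {U : ℝ → unitary (H →L[ℂ] H)}
    (hU : ∀ ψ : H, Continuous fun t => (U t : H →L[ℂ] H) ψ) {x : ℝ → H} {v a : H} {t₀ : ℝ}
    (hx : HasDerivAt x v t₀) (ha : HasDerivAt (fun t => (U t : H →L[ℂ] H) (x t₀)) a t₀) :
    HasDerivAt (fun t => (U t : H →L[ℂ] H) (x t)) (a + (U t₀ : H →L[ℂ] H) v) t₀ := by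
  rw [hasDerivAt_iff_tendsto_slope] at hx ha ⊢
  have h := ha.add (tendsto_unitary_apply (u := U) (((hU v).tendsto t₀).mono_left
    nhdsWithin_le_nhds) hx)
  refine h.congr fun t => ?_
  simp only [slope, vsub_eq_sub]
  rw [← Complex.coe_smul, ← Complex.coe_smul, ← Complex.coe_smul, map_smul, map_sub, ← smul_add]
  congr 1
  abel

end

section

variable {H : Type*} [NormedAddCommGroup H] [InnerProductSpace ℂ H] [CompleteSpace H]
  {A : H →ₗ.[ℂ] H} {V : H →L[ℂ] H} {U W : ℝ → unitary (H →L[ℂ] H)}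

namespace IsExpGroup

theorem map_neg (hU : IsExpGroup A U) (t : ℝ) : U (-t) = (U t)⁻¹ :=
  eq_inv_of_mul_eq_one_left (by rw [← hU.map_add, neg_add_cancel, hU.map_zero])

theorem apply_add (hU : IsExpGroup A U) (s t : ℝ) (ψ : H) :
    (U (s + t) : H →L[ℂ] H) ψ = (U s : H →L[ℂ] H) ((U t : H →L[ℂ] H) ψ) := by
  rw [hU.map_add]; rfl

theorem apply_zero (hU : IsExpGroup A U) (ψ : H) : (U 0 : H →L[ℂ] H) ψ = ψ := by
  rw [hU.map_zero]; rfl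

theorem map_nsmul (hU : IsExpGroup A U) (n : ℕ) (t : ℝ) : U (n * t) = U t ^ n := by
  induction n with
  | zero => simp [hU.map_zero]
  | succ n ih => rw [pow_succ, ← ih, ← hU.map_add]; congr 1; push_cast; ring

theorem hasDerivAt (hU : IsExpGroup A U) {ψ φ : H} (h : (ψ, φ) ∈ A.graph) (t : ℝ) :
    HasDerivAt (fun t => (U t : H →L[ℂ] H) ψ) (Complex.I • (U t : H →L[ℂ] H) φ) t := by
  have h0 : HasDerivAt (fun s => (U s : H →L[ℂ] H) ψ) (Complex.I • φ) (t - t) := by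
    rw [sub_self]; exact (hU.generator ψ φ).1 h
  have h1 := (((U t : H →L[ℂ] H).restrictScalars ℝ).hasFDerivAt.comp_hasDerivAt t
    (h0.comp_sub_const t t))
  simp only [ContinuousLinearMap.coe_restrictScalars', map_smul] at h1
  refine h1.congr_of_eventuallyEq (Filter.Eventually.of_forall fun s => ?_)
  simp [← hU.apply_add]

/-- The domain of the generator is invariant, and the generator commutes with its group. -/
theorem apply_mem_graph (hU : IsExpGroup A U) {ψ φ : H} (h : (ψ, φ) ∈ A.graph) (t : ℝ) :
    ((U t : H →L[ℂ] H) ψ, (U t : H →L[ℂ] H) φ) ∈ A.graph := by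
  rw [hU.generator]
  have h0 : HasDerivAt (fun s => (U s : H →L[ℂ] H) ψ) (Complex.I • (U t : H →L[ℂ] H) φ) (0 + t) := by
    rw [zero_add]; exact hU.hasDerivAt h t
  refine (h0.comp_add_const 0 t).congr_of_eventuallyEq (Filter.Eventually.of_forall fun s => ?_)
  simp [← hU.apply_add]

/-- Interaction picture: on the domain of `A`, the free evolution generated by `A` is cancelled
from the evolution generated by `V + A`, and only the bounded operator `V` drives the rest. -/
theorem hasDerivAt_interaction (hU : IsExpGroup A U)
    (hW : IsExpGroup ((V : H →ₗ[ℂ] H) +ᵥ A) W) {ψ : H} (hψ : ψ ∈ A.domain) (t : ℝ) :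
    HasDerivAt (fun t => (U (-t) : H →L[ℂ] H) ((W t : H →L[ℂ] H) ψ))
      (Complex.I • (U (-t) : H →L[ℂ] H) (V ((W t : H →L[ℂ] H) ψ))) t := by
  obtain ⟨φ, hφ⟩ := LinearPMap.mem_domain_iff.1 hψ
  have hφ' : (ψ, φ + V ψ) ∈ ((V : H →ₗ[ℂ] H) +ᵥ A).graph := by
    rw [mem_graph_vadd_iff]; simpa using hφ
  have h1 := hW.hasDerivAt hφ' t
  have h2 := hU.hasDerivAt (mem_graph_vadd_iff.1 (hW.apply_mem_graph hφ' t)) (-t)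
  have h3 := hasDerivAt_unitary_apply (U := fun t => U (-t))
    (fun ψ => (hU.strongly_continuous ψ).comp continuous_neg) h1 (h2.scomp t (hasDerivAt_neg t))
  convert h3 using 1
  simp only [map_sub, map_smul, smul_sub, neg_smul, one_smul, ContinuousLinearMap.coe_coe]
  abel

end IsExpGroup

end

/-! ### A product formula for reversing a perturbed evolution -/

section

variable {H : Type*} [NormedAddCommGroup H] [InnerProductSpace ℂ H] [CompleteSpace H]
  {A : H →ₗ.[ℂ] H} {V : H →L[ℂ] H} {U W W' : ℝ → unitary (H →L[ℂ] H)}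

/-- Telescoping: the error of `n` steps is at most `n` times the error of one step, measured
along the exact orbit. -/
theorem norm_pow_apply_sub_pow_apply_le (X Z : unitary (H →L[ℂ] H)) (ψ : H) {ε : ℝ} (n : ℕ)
    (h : ∀ k < n, ‖(X : H →L[ℂ] H) (((Z ^ k : unitary (H →L[ℂ] H)) : H →L[ℂ] H) ψ) -
      (Z : H →L[ℂ] H) (((Z ^ k : unitary (H →L[ℂ] H)) : H →L[ℂ] H) ψ)‖ ≤ ε) :
    ‖((X ^ n : unitary (H →L[ℂ] H)) : H →L[ℂ] H) ψ -
      ((Z ^ n : unitary (H →L[ℂ] H)) : H →L[ℂ] H) ψ‖ ≤ n * ε := by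
  induction n with
  | zero => simp
  | succ n ih =>
    have h1 := ih fun k hk => h k (hk.trans n.lt_succ_self)
    have h2 := h n n.lt_succ_self
    have e : ∀ Y : unitary (H →L[ℂ] H), ((Y ^ (n + 1) : unitary (H →L[ℂ] H)) : H →L[ℂ] H) ψ =
        (Y : H →L[ℂ] H) (((Y ^ n : unitary (H →L[ℂ] H)) : H →L[ℂ] H) ψ) := fun Y => by
      rw [pow_succ']; rfl
    rw [e, e, ← sub_add_sub_cancel _ ((X : H →L[ℂ] H)
      (((Z ^ n : unitary (H →L[ℂ] H)) : H →L[ℂ] H) ψ)), ← map_sub]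
    refine (norm_add_le _ _).trans ?_
    rw [Unitary.norm_map]
    rw [Nat.cast_add_one]
    linarith

namespace IsExpGroup

/-- One step of the splitting `-(A + V) = -2A + (A - V)`. The two curves compared are the
interaction pictures of `A - V` and of the reversed `A + V`; both start at `φ`, so the mean value
inequality bounds their distance by that of their velocities. -/
theorem norm_splitting_step_le (hU : IsExpGroup A U)
    (hW : IsExpGroup ((V : H →ₗ[ℂ] H) +ᵥ A) W)
    (hW' : IsExpGroup (((-V : H →L[ℂ] H) : H →ₗ[ℂ] H) +ᵥ A) W') {φ : H} (hφ : φ ∈ A.domain)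
    {h M : ℝ} (hh : 0 ≤ h)
    (hM : ∀ r ∈ Set.Icc 0 h, ‖(U (-r) : H →L[ℂ] H) (V ((W' r : H →L[ℂ] H) φ)) -
      (U r : H →L[ℂ] H) (V ((W (-r) : H →L[ℂ] H) φ))‖ ≤ M) :
    ‖((U (-h) * U (-h) * W' h : unitary (H →L[ℂ] H)) : H →L[ℂ] H) φ -
      (W (-h) : H →L[ℂ] H) φ‖ ≤ M * h := by
  have hd : ∀ r : ℝ, HasDerivAt (fun r => (U (-r) : H →L[ℂ] H) ((W' r : H →L[ℂ] H) φ) -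
      (U r : H →L[ℂ] H) ((W (-r) : H →L[ℂ] H) φ))
      (-(Complex.I • ((U (-r) : H →L[ℂ] H) (V ((W' r : H →L[ℂ] H) φ)) -
        (U r : H →L[ℂ] H) (V ((W (-r) : H →L[ℂ] H) φ))))) r := by
    intro r
    have h1 := hU.hasDerivAt_interaction hW' hφ r
    have h2 := (hU.hasDerivAt_interaction hW hφ (-r)).scomp r (hasDerivAt_neg r)
    simp only [Function.comp_def, neg_neg] at h2
    refine (h1.fun_sub h2).congr_deriv ?_
    simp only [neg_smul, one_smul, neg_apply, _root_.map_neg, smul_neg, smul_sub]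
    abel
  have hmv := norm_image_sub_le_of_norm_deriv_le_segment' (a := 0) (b := h) (C := M)
    (fun r _ => (hd r).hasDerivWithinAt)
    (fun r hr => by
      rw [norm_neg, norm_smul, Complex.norm_I, one_mul]
      exact hM r ⟨hr.1, hr.2.le⟩) h ⟨hh, le_rfl⟩
  simp only [neg_zero, hU.apply_zero, hW.apply_zero, hW'.apply_zero, sub_self, sub_zero] at hmv
  rw [← Unitary.norm_map (U (-h)), map_sub, ← hU.apply_add (-h) h, neg_add_cancel,
    hU.apply_zero] at hmv
  exact hmv

/-- A Trotter product formula that runs the perturbed evolution forward in time: the backward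
evolution of `A + V` is a limit of products of forward evolutions of `A - V` and backward
evolutions of `A`. -/
theorem tendsto_splitting (hA : Dense (A.domain : Set H)) (hU : IsExpGroup A U)
    (hW : IsExpGroup ((V : H →ₗ[ℂ] H) +ᵥ A) W)
    (hW' : IsExpGroup (((-V : H →L[ℂ] H) : H →ₗ[ℂ] H) +ᵥ A) W') {τ : ℝ} (hτ : 0 ≤ τ) (ψ : H) :
    Filter.Tendsto (fun n : ℕ =>
      (((U (-(τ / n)) * U (-(τ / n)) * W' (τ / n)) ^ n : unitary (H →L[ℂ] H)) : H →L[ℂ] H) ψ)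
      Filter.atTop (𝓝 ((W (-τ) : H →L[ℂ] H) ψ)) := by
  refine tendsto_unitary_apply_of_dense hA (fun ψ hψ => ?_) ψ
  have hdom : ∀ t : ℝ, (W t : H →L[ℂ] H) ψ ∈ A.domain := fun t => by
    obtain ⟨φ, hφ⟩ := LinearPMap.mem_domain_iff.1 hψ
    have hφ' : (ψ, φ + V ψ) ∈ ((V : H →ₗ[ℂ] H) +ᵥ A).graph := by
      rw [mem_graph_vadd_iff]; simpa using hφ
    exact LinearPMap.mem_domain_iff.2 ⟨_, mem_graph_vadd_iff.1 (hW.apply_mem_graph hφ' t)⟩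
  let F : ℝ × ℝ → ℝ := fun p =>
    ‖(U (-p.1) : H →L[ℂ] H) (V ((W' p.1 : H →L[ℂ] H) ((W (-p.2) : H →L[ℂ] H) ψ))) -
      (U p.1 : H →L[ℂ] H) (V ((W (-p.1) : H →L[ℂ] H) ((W (-p.2) : H →L[ℂ] H) ψ)))‖
  have hF : Continuous F := by
    have c1 : Continuous fun p : ℝ × ℝ => (W (-p.2) : H →L[ℂ] H) ψ :=
      (hW.strongly_continuous ψ).comp continuous_snd.neg
    have c2 := continuous_unitary_apply (u := fun p : ℝ × ℝ => W' p.1)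
      (fun ψ => (hW'.strongly_continuous ψ).comp continuous_fst) c1
    have c3 := continuous_unitary_apply (u := fun p : ℝ × ℝ => W (-p.1))
      (fun ψ => (hW.strongly_continuous ψ).comp continuous_fst.neg) c1
    have c4 := continuous_unitary_apply (u := fun p : ℝ × ℝ => U (-p.1))
      (fun ψ => (hU.strongly_continuous ψ).comp continuous_fst.neg) (V.continuous.comp c2)
    have c5 := continuous_unitary_apply (u := fun p : ℝ × ℝ => U p.1)
      (fun ψ => (hU.strongly_continuous ψ).comp continuous_fst) (V.continuous.comp c3)
    exact (c4.sub c5).norm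
  have hF0 : ∀ t : ℝ, F (0, t) = 0 := fun t => by
    simp [F, hU.apply_zero, hW.apply_zero, hW'.apply_zero]
  rw [Metric.tendsto_nhds]
  intro ε hε
  have hε' : 0 < ε / (τ + 1) := by positivity
  -- The velocities agree at `r = 0`, hence are uniformly close along the compact orbit of `ψ`.
  have hunif : ∀ᶠ r in 𝓝 (0 : ℝ), ∀ t ∈ Set.Icc 0 τ, F (r, t) < ε / (τ + 1) :=
    isCompact_Icc.eventually_forall_of_forall_eventually fun t _ =>
      hF.continuousAt.eventually_lt continuousAt_const (by rw [hF0]; exact hε')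
  obtain ⟨δ, hδ, hball⟩ := Metric.eventually_nhds_iff.1 hunif
  have hlim : Filter.Tendsto (fun n : ℕ => τ / n) Filter.atTop (𝓝 0) :=
    tendsto_const_div_atTop_nhds_zero_nat τ
  filter_upwards [Metric.tendsto_nhds.1 hlim δ hδ, Filter.eventually_gt_atTop 0] with n hn hn0
  have hn' : (0 : ℝ) < n := by exact_mod_cast hn0
  have hh : 0 ≤ τ / n := by positivity
  have hpow : ∀ k : ℕ, W (-(τ / n)) ^ k = W (-(k * (τ / n))) := fun k => by
    rw [← hW.map_nsmul]; congr 1; ring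
  have hstep := norm_pow_apply_sub_pow_apply_le (U (-(τ / n)) * U (-(τ / n)) * W' (τ / n))
    (W (-(τ / n))) ψ (ε := ε / (τ + 1) * (τ / n)) n fun k hk => by
      rw [hpow]
      refine norm_splitting_step_le hU hW hW' (hdom _) hh fun r hr => ?_
      refine (hball (y := r) ?_ (k * (τ / n)) ⟨by positivity, ?_⟩).le
      · rw [Real.dist_eq, sub_zero, abs_of_nonneg hr.1]
        rw [Real.dist_eq, sub_zero, abs_of_nonneg hh] at hn
        exact hr.2.trans_lt hn
      · calc (k : ℝ) * (τ / n) ≤ n * (τ / n) := by gcongr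
          _ = τ := by field_simp
  rw [hpow, mul_div_cancel₀ τ hn'.ne'] at hstep
  rw [dist_eq_norm]
  calc _ ≤ _ := hstep
    _ = ε * (τ / (τ + 1)) := by field_simp
    _ < ε := mul_lt_of_lt_one_right hε ((div_lt_one (by positivity)).2 (by linarith))

end IsExpGroup

end

/-! ### Bounded perturbations of generators -/

section

variable {H : Type*} [NormedAddCommGroup H] [InnerProductSpace ℂ H]

/-- `w` solves the linear evolution equation `w' = B t w` on the whole real line. -/
def IsSolution (B : ℝ → H →L[ℂ] H) (w : ℝ → H) : Prop :=
  ∀ t : ℝ, HasDerivAt w (B t (w t)) t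

/-- The terms of the Dyson series of `w' = B t w`, `w 0 = ψ`: iterated time-ordered integrals. -/
noncomputable def dysonTerm (B : ℝ → H →L[ℂ] H) (ψ : H) : ℕ → ℝ → H
  | 0 => fun _ => ψ
  | n + 1 => fun t => ∫ s in (0 : ℝ)..t, B s (dysonTerm B ψ n s)

variable {B : ℝ → H →L[ℂ] H} {C : ℝ}

theorem continuous_apply_of_bound (hB : ∀ ψ : H, Continuous fun t => B t ψ)
    (hC : ∀ t ψ, ‖B t ψ‖ ≤ C * ‖ψ‖) {x : ℝ → H} (hx : Continuous x) :
    Continuous fun t => B t (x t) := by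
  refine continuous_iff_continuousAt.2 fun t₀ => ?_
  have h1 : Filter.Tendsto (fun t => B t (x t - x t₀)) (𝓝 t₀) (𝓝 0) := by
    refine squeeze_zero_norm (fun t => hC t _) ?_
    have : Continuous fun t => C * ‖x t - x t₀‖ := by fun_prop
    simpa using this.tendsto t₀
  simpa [ContinuousAt] using h1.add ((hB (x t₀)).tendsto t₀)

theorem continuous_dysonTerm [CompleteSpace H] (hB : ∀ ψ : H, Continuous fun t => B t ψ)
    (hC : ∀ t ψ, ‖B t ψ‖ ≤ C * ‖ψ‖) (ψ : H) (n : ℕ) : Continuous (dysonTerm B ψ n) := by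
  induction n with
  | zero => exact continuous_const
  | succ n ih =>
    exact intervalIntegral.continuous_primitive
      (fun a b => (continuous_apply_of_bound hB hC ih).intervalIntegrable a b) 0

theorem hasDerivAt_dysonTerm_succ [CompleteSpace H] (hB : ∀ ψ : H, Continuous fun t => B t ψ)
    (hC : ∀ t ψ, ‖B t ψ‖ ≤ C * ‖ψ‖) (ψ : H) (n : ℕ) (t : ℝ) :
    HasDerivAt (dysonTerm B ψ (n + 1)) (B t (dysonTerm B ψ n t)) t :=
  (continuous_apply_of_bound hB hC (continuous_dysonTerm hB hC ψ n)).integral_hasStrictDerivAt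
    0 t |>.hasDerivAt

theorem norm_dysonTerm_le [CompleteSpace H] (hB : ∀ ψ : H, Continuous fun t => B t ψ)
    (hC0 : 0 ≤ C) (hC : ∀ t ψ, ‖B t ψ‖ ≤ C * ‖ψ‖) (ψ : H) (n : ℕ) (t : ℝ) :
    ‖dysonTerm B ψ n t‖ ≤ ‖ψ‖ * ((C * |t|) ^ n / n.factorial) := by
  induction n generalizing t with
  | zero => simp [dysonTerm]
  | succ n ih =>
    calc ‖dysonTerm B ψ (n + 1) t‖
        ≤ ∫ s in Set.uIoc 0 t, ‖B s (dysonTerm B ψ n s)‖ :=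
          intervalIntegral.norm_integral_le_integral_norm_uIoc
      _ ≤ ∫ s in Set.uIoc 0 t, C * (‖ψ‖ * (C ^ n / n.factorial)) * |s - 0| ^ n := by
          refine MeasureTheory.setIntegral_mono ?_ ?_ fun s => ?_
          · exact ((continuous_apply_of_bound hB hC
              (continuous_dysonTerm hB hC ψ n)).norm.intervalIntegrable 0 t).def'
          · exact (Continuous.intervalIntegrable (by fun_prop) 0 t).def'
          · refine (hC s _).trans ?_
            refine (mul_le_mul_of_nonneg_left (ih s) hC0).trans_eq ?_
            rw [sub_zero, mul_pow]; ring
      _ = ‖ψ‖ * ((C * |t|) ^ (n + 1) / (n + 1).factorial) := by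
          rw [MeasureTheory.integral_const_mul, integral_pow_abs_sub_uIoc, sub_zero,
            Nat.factorial_succ, mul_pow]
          push_cast
          field_simp
          ring_nf

/-- Global solvability: the Dyson series converges locally uniformly, and so does the series of its
derivatives. -/
theorem exists_isSolution [CompleteSpace H] (hB : ∀ ψ : H, Continuous fun t => B t ψ)
    (hC0 : 0 ≤ C) (hC : ∀ t ψ, ‖B t ψ‖ ≤ C * ‖ψ‖) (ψ : H) :
    ∃ w : ℝ → H, w 0 = ψ ∧ IsSolution B w := by
  have hsum : ∀ t : ℝ, Summable fun n => dysonTerm B ψ n t := fun t =>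
    Summable.of_norm_bounded ((Real.summable_pow_div_factorial (C * |t|)).mul_left ‖ψ‖)
      fun n => norm_dysonTerm_le hB hC0 hC ψ n t
  refine ⟨fun t => ψ + ∑' n, dysonTerm B ψ (n + 1) t, by simp [dysonTerm], fun t => ?_⟩
  obtain ⟨R, hR⟩ := exists_gt |t|
  have hR0 : 0 < R := (abs_nonneg t).trans_lt hR
  have hder := hasDerivAt_tsum_of_isPreconnected
    (u := fun n => C * (‖ψ‖ * ((C * R) ^ n / n.factorial)))
    (g := fun n => dysonTerm B ψ (n + 1)) (g' := fun n s => B s (dysonTerm B ψ n s))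
    (t := Metric.ball 0 R) (y₀ := 0) (y := t)
    (((Real.summable_pow_div_factorial (C * R)).mul_left ‖ψ‖).mul_left C)
    Metric.isOpen_ball (convex_ball 0 R).isPreconnected
    (fun n s _ => hasDerivAt_dysonTerm_succ hB hC ψ n s)
    (fun n s hs => by
      refine (hC s _).trans (mul_le_mul_of_nonneg_left ?_ hC0)
      refine (norm_dysonTerm_le hB hC0 hC ψ n s).trans ?_
      have : |s| ≤ R := by simpa using (mem_ball_zero_iff.1 hs).le
      gcongr)
    (Metric.mem_ball_self hR0) ((summable_nat_add_iff 1).2 (hsum 0)) (by simpa using hR)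
  refine (hder.const_add ψ).congr_deriv ?_
  rw [← (B t).map_tsum (hsum t), (hsum t).tsum_eq_zero_add]
  rfl

namespace IsSolution

/-- If every `B t` is skew-adjoint, the inner product of two solutions is conserved. -/
theorem inner_eq (hB : ∀ t x y, inner ℂ (B t x) y = -inner ℂ x (B t y)) {v w : ℝ → H}
    (hv : IsSolution B v) (hw : IsSolution B w) (t : ℝ) :
    inner ℂ (v t) (w t) = inner ℂ (v 0) (w 0) := by
  have h : ∀ s : ℝ, HasDerivAt (fun s => inner ℂ (v s) (w s)) 0 s := fun s =>
    ((hv s).inner ℂ (hw s)).congr_deriv (by rw [hB]; simp)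
  exact is_const_of_deriv_eq_zero (fun s => (h s).differentiableAt) (fun s => (h s).deriv) t 0

theorem norm_eq (hB : ∀ t x y, inner ℂ (B t x) y = -inner ℂ x (B t y)) {w : ℝ → H}
    (hw : IsSolution B w) (t : ℝ) : ‖w t‖ = ‖w 0‖ := by
  rw [← sq_eq_sq₀ (norm_nonneg _) (norm_nonneg _)]
  have h := hw.inner_eq hB hw t
  rw [inner_self_eq_norm_sq_to_K, inner_self_eq_norm_sq_to_K] at h
  exact_mod_cast h

theorem add {v w : ℝ → H} (hv : IsSolution B v) (hw : IsSolution B w) :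
    IsSolution B fun t => v t + w t := fun t =>
  ((hv t).fun_add (hw t)).congr_deriv (map_add _ _ _).symm

theorem smul {w : ℝ → H} (hw : IsSolution B w) (c : ℂ) : IsSolution B fun t => c • w t :=
  fun t => ((hw t).fun_const_smul c).congr_deriv (map_smul _ _ _).symm

/-- Solutions of a skew-adjoint equation are determined by their initial value: the norm of their
difference is conserved. -/
theorem eq_of_eq_zero (hB : ∀ t x y, inner ℂ (B t x) y = -inner ℂ x (B t y)) {v w : ℝ → H}
    (hv : IsSolution B v) (hw : IsSolution B w) (h : v 0 = w 0) (t : ℝ) : v t = w t := by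
  have h1 := (hv.add (hw.smul (-1))).norm_eq hB t
  simp only [h, neg_smul, one_smul, add_neg_cancel, norm_zero] at h1
  simpa [add_neg_eq_zero] using h1

end IsSolution

end

section

variable {H : Type*} [NormedAddCommGroup H] [InnerProductSpace ℂ H] [CompleteSpace H]
  {A : H →ₗ.[ℂ] H} {V : H →L[ℂ] H} {U : ℝ → unitary (H →L[ℂ] H)}

namespace IsExpGroup

theorem inner_neg_apply (hU : IsExpGroup A U) (t : ℝ) (x y : H) :
    inner ℂ ((U (-t) : H →L[ℂ] H) x) y = inner ℂ x ((U t : H →L[ℂ] H) y) := by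
  rw [← Unitary.inner_map_map (U t), ← hU.apply_add, add_neg_cancel, hU.apply_zero]

/-- The bounded perturbation theorem for unitary groups: `V + A` generates a unitary group if `A`
does and `V` is bounded and symmetric. The group is `U t ∘ T t`, with `T` the propagator of the
interaction picture `w' = i U(-t) V U(t) w`. -/
theorem exists_perturbation (hU : IsExpGroup A U) (hV : (V : H →ₗ[ℂ] H).IsSymmetric) :
    ∃ W, IsExpGroup ((V : H →ₗ[ℂ] H) +ᵥ A) W := by
  let B : ℝ → H →L[ℂ] H := fun t =>
    Complex.I • ((U (-t) : H →L[ℂ] H) ∘L V ∘L (U t : H →L[ℂ] H))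
  have hBapp : ∀ t ψ, B t ψ =
      Complex.I • (U (-t) : H →L[ℂ] H) (V ((U t : H →L[ℂ] H) ψ)) := fun _ _ => rfl
  have hBc : ∀ ψ : H, Continuous fun t => B t ψ := fun ψ =>
    (continuous_unitary_apply (u := fun t => U (-t))
      (fun ψ => (hU.strongly_continuous ψ).comp continuous_neg)
      (V.continuous.comp (hU.strongly_continuous ψ))).const_smul Complex.I
  have hBb : ∀ t ψ, ‖B t ψ‖ ≤ ‖V‖ * ‖ψ‖ := fun t ψ => by
    rw [hBapp, norm_smul, Complex.norm_I, one_mul, Unitary.norm_map]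
    exact (V.le_opNorm _).trans_eq (by rw [Unitary.norm_map])
  have hBs : ∀ t x y, inner ℂ (B t x) y = -inner ℂ x (B t y) := fun t x y => by
    have h1 := hV ((U t : H →L[ℂ] H) x) ((U t : H →L[ℂ] H) y)
    have h2 := hU.inner_neg_apply (-t) x (V ((U t : H →L[ℂ] H) y))
    simp only [ContinuousLinearMap.coe_coe] at h1
    rw [neg_neg] at h2
    rw [hBapp, hBapp, inner_smul_left, inner_smul_right, hU.inner_neg_apply, h1, h2]
    simp
  choose T hT0 hT using exists_isSolution hBc (norm_nonneg V) hBb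
  have hT_eq : ∀ {w : ℝ → H}, IsSolution B w → ∀ t, w t = T (w 0) t := fun hw t =>
    hw.eq_of_eq_zero hBs (hT _) (hT0 _).symm t
  let W₀ : ℝ → H → H := fun t ψ => (U t : H →L[ℂ] H) (T ψ t)
  have hW₀_zero : ∀ ψ, W₀ 0 ψ = ψ := fun ψ => by simp only [W₀, hU.apply_zero, hT0]
  -- `t ↦ U s (T ψ (t + s))` solves the same equation, because `U s B(t + s) U(-s) = B t`.
  have hW₀_add : ∀ s t ψ, W₀ (t + s) ψ = W₀ t (W₀ s ψ) := by
    intro s t ψ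
    have hy : IsSolution B fun t => (U s : H →L[ℂ] H) (T ψ (t + s)) := by
      intro t
      have h1 := ((U s : H →L[ℂ] H).restrictScalars ℝ).hasFDerivAt.comp_hasDerivAt t
        ((hT ψ (t + s)).comp_add_const t s)
      refine h1.congr_deriv ?_
      simp only [ContinuousLinearMap.coe_restrictScalars', hBapp, map_smul]
      rw [← hU.apply_add, ← hU.apply_add]
      rw [show s + -(t + s) = -t by ring, add_comm t s]
    have h2 := hT_eq hy t
    simp only [zero_add] at h2
    simp only [W₀]
    rw [← h2, hU.apply_add]
  let W : ℝ → unitary (H →L[ℂ] H) := fun t => Unitary.linearIsometryEquiv.symm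
    { toFun := W₀ t
      map_add' := fun x y => by
        have h := hT_eq ((hT x).add (hT y)) t
        simp only [hT0] at h
        simp only [W₀, ← h]
        exact _root_.map_add (U t : H →L[ℂ] H) _ _
      map_smul' := fun c x => by
        have h := hT_eq ((hT x).smul c) t
        simp only [hT0] at h
        simp only [W₀, ← h]
        exact map_smul (U t : H →L[ℂ] H) _ _
      invFun := W₀ (-t)
      left_inv := fun x => by rw [← hW₀_add, neg_add_cancel, hW₀_zero]
      right_inv := fun x => by rw [← hW₀_add, add_neg_cancel, hW₀_zero]
      norm_map' := fun x => by
        change ‖W₀ t x‖ = ‖x‖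
        simp only [W₀]
        rw [Unitary.norm_map, (hT x).norm_eq hBs, hT0] }
  have hW : ∀ t ψ, (W t : H →L[ℂ] H) ψ = (U t : H →L[ℂ] H) (T ψ t) := fun _ _ => rfl
  refine ⟨W, ⟨?_, fun s t => ?_, fun ψ => ?_, fun ψ φ => ?_⟩⟩
  · ext ψ
    exact hW₀_zero ψ
  · ext ψ
    exact hW₀_add t s ψ
  · simp only [hW]
    exact continuous_unitary_apply hU.strongly_continuous
      (continuous_iff_continuousAt.2 fun t => (hT ψ t).continuousAt)
  · have hTd : HasDerivAt (T ψ) (Complex.I • V ψ) 0 := by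
      refine (hT ψ 0).congr_deriv ?_
      rw [hBapp, neg_zero, hU.apply_zero, hU.apply_zero, hT0]
    rw [mem_graph_vadd_iff, hU.generator]
    simp only [hW]
    constructor
    · intro h
      refine (hasDerivAt_unitary_apply hU.strongly_continuous hTd
        (a := Complex.I • (φ - V ψ)) (by rw [hT0]; exact h)).congr_deriv ?_
      rw [hU.apply_zero, smul_sub, sub_add_cancel]
    · intro h
      have h1 := hasDerivAt_unitary_apply hU.strongly_continuous (hTd.sub_const ψ) (a := 0)
        (by simpa [hT0] using hasDerivAt_const (0 : ℝ) (0 : H))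
      have h2 := h.fun_sub h1
      simp only [← map_sub, sub_sub_cancel] at h2
      exact h2.congr_deriv (by rw [hU.apply_zero, zero_add, smul_sub]; rfl)

end IsExpGroup

end

/-! ### Recurrence for pure point spectrum -/

section

variable {ι : Type*} {G : ι → Type*} [∀ i, NormedAddCommGroup (G i)]
  [∀ i, InnerProductSpace ℂ (G i)]

/-- The unitary operator on a Hilbert sum that multiplies the `i`-th component by the phase
`g i`. -/
noncomputable def lpPhase (g : ι → Circle) : lp G 2 ≃ₗᵢ[ℂ] lp G 2 :=
  have hmem : ∀ (g : ι → Circle) (f : lp G 2), Memℓp (fun i => (g i : ℂ) • f i) 2 := fun g f => by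
    have h := lp.memℓp f
    rw [memℓp_gen_iff (by norm_num)] at h ⊢
    simpa [norm_smul, Circle.norm_coe] using h
  { toFun := fun f => ⟨fun i => (g i : ℂ) • f i, hmem g f⟩
    map_add' := fun f f' => by ext i; exact smul_add _ _ _
    map_smul' := fun c f => by ext i; exact smul_comm _ _ _
    invFun := fun f => ⟨fun i => ((g⁻¹) i : ℂ) • f i, hmem g⁻¹ f⟩
    left_inv := fun f => by ext i; simp [smul_smul]
    right_inv := fun f => by ext i; simp [smul_smul]
    norm_map' := fun f => by
      rw [lp.norm_eq_tsum_rpow (by norm_num), lp.norm_eq_tsum_rpow (by norm_num)]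
      simp [norm_smul, Circle.norm_coe] }

theorem lpPhase_single [DecidableEq ι] (g : ι → Circle) (i : ι) (x : G i) :
    lpPhase g (lp.single 2 i x) = (g i : ℂ) • lp.single 2 i x := by
  ext j
  change (g j : ℂ) • (lp.single 2 i x : lp G 2) j = (g i : ℂ) • (lp.single 2 i x : lp G 2) j
  by_cases h : j = i
  · rw [h]
  · simp [h]

end

section

variable {H : Type*} [NormedAddCommGroup H] [InnerProductSpace ℂ H] [CompleteSpace H]
  {ι : Type*} {E : ι → Submodule ℂ H}

/-- A Hilbert sum decomposition makes the torus `ι → Circle` act by unitaries that are diagonal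
with respect to the decomposition. -/
theorem exists_diagonal_unitary (hE : IsHilbertSum ℂ (fun i => E i) fun i => (E i).subtypeₗᵢ)
    (g : ι → Circle) : ∃ u : unitary (H →L[ℂ] H), ∀ i, ∀ ψ ∈ E i,
      (u : H →L[ℂ] H) ψ = (g i : ℂ) • ψ := by
  classical
  let e := hE.linearIsometryEquiv
  refine ⟨Unitary.linearIsometryEquiv.symm ((e.trans (lpPhase g)).trans e.symm), fun i ψ hψ => ?_⟩
  have h := hE.linearIsometryEquiv_symm_apply_single (⟨ψ, hψ⟩ : E i)
  have h' : e ψ = lp.single 2 i ⟨ψ, hψ⟩ := by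
    rw [← e.apply_symm_apply (lp.single 2 i ⟨ψ, hψ⟩)]; congr 1; exact h.symm
  change e.symm (lpPhase g (e ψ)) = _
  rw [h', lpPhase_single, map_smul]
  congr 1

variable (hE : Dense ((⨆ i, E i : Submodule ℂ H) : Set H))
include hE

theorem unitary_ext_of_dense_iSup {u v : unitary (H →L[ℂ] H)}
    (h : ∀ i, ∀ ψ ∈ E i, (u : H →L[ℂ] H) ψ = (v : H →L[ℂ] H) ψ) : u = v := by
  rw [Submodule.iSup_eq_span] at hE
  refine Subtype.ext (ContinuousLinearMap.ext_on hE fun ψ hψ => ?_)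
  obtain ⟨i, hi⟩ := Set.mem_iUnion.1 hψ
  exact h i ψ hi

theorem strongly_continuous_of_diagonal {D : (ι → Circle) → unitary (H →L[ℂ] H)}
    (hD : ∀ g i, ∀ ψ ∈ E i, (D g : H →L[ℂ] H) ψ = (g i : ℂ) • ψ) (ψ : H) :
    Continuous fun g => (D g : H →L[ℂ] H) ψ := by
  refine continuous_iff_continuousAt.2 fun g => tendsto_unitary_apply_of_dense hE (fun ψ hψ => ?_) ψ
  refine Continuous.tendsto (f := fun g => (D g : H →L[ℂ] H) ψ) ?_ g
  induction hψ using Submodule.iSup_induction' with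
  | mem i φ hφ =>
    simp only [hD _ i φ hφ]
    fun_prop
  | zero => simpa using continuous_const
  | add φ φ' _ _ h h' => simpa only [map_add] using h.fun_add h'

end

section

variable {H : Type*} [NormedAddCommGroup H] [InnerProductSpace ℂ H]

/-- The eigenspace of a partially defined operator for a real eigenvalue `μ`; it is trivial if `μ`
is not an eigenvalue. -/
def eigenspace (A : H →ₗ.[ℂ] H) (μ : ℝ) : Submodule ℂ H :=
  A.graph.comap (LinearMap.id.prod ((μ : ℂ) • LinearMap.id))

theorem mem_eigenspace {A : H →ₗ.[ℂ] H} {μ : ℝ} {ψ : H} :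
    ψ ∈ eigenspace A μ ↔ (ψ, (μ : ℂ) • ψ) ∈ A.graph := Iff.rfl

variable [CompleteSpace H] {A : H →ₗ.[ℂ] H}

theorem inner_graph_symm (hA : IsSelfAdjoint A) {ψ φ ψ' φ' : H} (h : (ψ, φ) ∈ A.graph)
    (h' : (ψ', φ') ∈ A.graph) : inner ℂ φ ψ' = inner ℂ ψ φ' := by
  obtain ⟨x, rfl, rfl⟩ := (LinearPMap.mem_graph_iff A).1 h
  obtain ⟨y, rfl, rfl⟩ := (LinearPMap.mem_graph_iff A).1 h'
  have h := LinearPMap.adjoint_isFormalAdjoint hA.dense_domain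
  rw [LinearPMap.isSelfAdjoint_def.1 hA] at h
  exact h x y

/-- A selfadjoint operator has no proper symmetric extension. -/
theorem mem_graph_of_inner_eq (hA : IsSelfAdjoint A) {ψ φ : H}
    (h : ∀ ψ' φ', (ψ', φ') ∈ A.graph → inner ℂ φ ψ' = inner ℂ ψ φ') : (ψ, φ) ∈ A.graph := by
  have hx : ∀ x : A.domain, inner ℂ φ (x : H) = inner ℂ ψ (A x) := fun x => h _ _ (A.mem_graph x)
  have hdom := LinearPMap.mem_adjoint_domain_of_exists ψ ⟨φ, hx⟩
  have heq := LinearPMap.adjoint_apply_eq hA.dense_domain ⟨ψ, hdom⟩ hx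
  rw [← LinearPMap.isSelfAdjoint_def.1 hA, LinearPMap.mem_graph_iff]
  exact ⟨⟨ψ, hdom⟩, rfl, heq⟩

/-- The eigenspaces are orthogonal, and closed because a selfadjoint operator is. -/
theorem isHilbertSum_eigenspace (hA : IsSelfAdjoint A)
    (hd : Dense ((⨆ μ, eigenspace A μ : Submodule ℂ H) : Set H)) :
    IsHilbertSum ℂ (fun μ => eigenspace A μ) fun μ => (eigenspace A μ).subtypeₗᵢ := by
  have hc : ∀ μ, CompleteSpace (eigenspace A μ) := fun μ => by
    have : IsClosed (eigenspace A μ : Set H) :=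
      IsClosed.preimage (f := fun ψ : H => (ψ, (μ : ℂ) • ψ)) (by fun_prop) hA.isClosed
    exact this.completeSpace_coe
  refine IsHilbertSum.mkInternal (eigenspace A) (fun μ ν hμν ψ φ => ?_)
    ((Submodule.dense_iff_topologicalClosure_eq_top.1 hd).ge)
  have h := inner_graph_symm hA (mem_eigenspace.1 ψ.2) (mem_eigenspace.1 φ.2)
  rw [inner_smul_left, inner_smul_right, Complex.conj_ofReal] at h
  exact (mul_eq_mul_right_iff.1 h).resolve_left fun h => hμν (Complex.ofReal_injective h)

/-- Total eigenvectors make the eigenspaces of real eigenvalues total: an eigenvalue of a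
selfadjoint operator is real unless its eigenvector is `0`. -/
theorem dense_iSup_eigenspace (hA : IsSelfAdjoint A) (hpp : HasPurePointSpectrum A) :
    Dense ((⨆ μ, eigenspace A μ : Submodule ℂ H) : Set H) := by
  refine (Submodule.dense_iff_topologicalClosure_eq_top.2 hpp).mono (Submodule.span_le.2 ?_)
  rintro ψ ⟨μ, hμ⟩
  by_cases hψ : ψ = 0
  · rw [hψ]; exact zero_mem _
  have h := inner_graph_symm hA hμ hμ
  rw [inner_smul_left, inner_smul_right] at h
  have hre : (starRingEnd ℂ) μ = μ :=
    (mul_eq_mul_right_iff.1 h).resolve_right (inner_self_ne_zero.2 hψ)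
  refine Submodule.mem_iSup_of_mem μ.re ?_
  rw [mem_eigenspace, Complex.conj_eq_iff_re.1 hre]
  exact hμ

/-- A strongly continuous unitary group that acts by `exp (i t μ)` on the eigenspaces of a
selfadjoint operator with pure point spectrum is generated by that operator. -/
theorem isExpGroup_of_eigenspace (hA : IsSelfAdjoint A)
    (hd : Dense ((⨆ μ, eigenspace A μ : Submodule ℂ H) : Set H)) {U : ℝ → unitary (H →L[ℂ] H)}
    (hU : ∀ t μ, ∀ ψ ∈ eigenspace A μ,
      (U t : H →L[ℂ] H) ψ = (Circle.exp (t * μ) : ℂ) • ψ)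
    (hc : ∀ ψ : H, Continuous fun t => (U t : H →L[ℂ] H) ψ) : IsExpGroup A U := by
  have h0 : U 0 = 1 := unitary_ext_of_dense_iSup hd fun μ ψ hψ => by
    rw [hU _ μ ψ hψ]; simp
  have hgen : ∀ ψ φ, (ψ, φ) ∈ A.graph →
      HasDerivAt (fun t => (U t : H →L[ℂ] H) ψ) (Complex.I • φ) 0 := by
    intro ψ φ h
    have hprim := fun t : ℝ => ((hc φ).fun_const_smul Complex.I).integral_hasStrictDerivAt 0 t
    -- The integrated evolution equation holds weakly, tested against eigenvectors.
    have key : ∀ t : ℝ, (U t : H →L[ℂ] H) ψ =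
        ψ + ∫ s in (0 : ℝ)..t, Complex.I • (U s : H →L[ℂ] H) φ := by
      intro t
      rw [← sub_eq_zero]
      refine hd.eq_zero_of_inner_right ℂ fun e he => ?_
      induction he using Submodule.iSup_induction' with
      | mem μ e he =>
        have hinner : ∀ s χ, inner ℂ e ((U s : H →L[ℂ] H) χ) =
            Complex.exp (s * μ * Complex.I) * inner ℂ e χ := by
          intro s χ
          rw [← Unitary.inner_map_map (U s) e χ, hU s μ e he, inner_smul_left, ← mul_assoc,
            ← Circle.coe_inv_eq_conj, ← Complex.ofReal_mul, ← Circle.coe_exp, ← Circle.coe_mul]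
          simp
        have hμ : inner ℂ e φ = μ * inner ℂ e ψ := by
          rw [← inner_graph_symm hA (mem_eigenspace.1 he) h, inner_smul_left, Complex.conj_ofReal]
        have hderiv : ∀ s : ℝ, HasDerivAt (fun s => inner ℂ e ((U s : H →L[ℂ] H) ψ -
            (ψ + ∫ r in (0 : ℝ)..s, Complex.I • (U r : H →L[ℂ] H) φ))) 0 s := by
          intro s
          simp only [inner_sub_right, hinner]
          have h1 : HasDerivAt (fun s : ℝ => Complex.exp (s * μ * Complex.I) * inner ℂ e ψ)
              (Complex.exp (s * μ * Complex.I) * (1 * μ * Complex.I) * inner ℂ e ψ) s :=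
            ((((Complex.ofRealCLM.hasDerivAt (x := s)).mul_const (μ : ℂ)).mul_const
              Complex.I).cexp).mul_const _
          have h2 := (hasDerivAt_const s e).inner ℂ ((hprim s).hasDerivAt.const_add ψ)
          refine (h1.fun_sub h2).congr_deriv ?_
          rw [inner_smul_right, hinner, hμ, inner_zero_left]
          ring
        refine (is_const_of_deriv_eq_zero (fun s => (hderiv s).differentiableAt)
          (fun s => (hderiv s).deriv) t 0).trans ?_
        simp [h0]
      | zero => simp
      | add e e' _ _ he he' => rw [inner_add_left, he, he', add_zero]
    simp only [key]
    refine ((hprim 0).hasDerivAt.const_add ψ).congr_deriv ?_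
    rw [h0]; rfl
  refine ⟨h0, fun s t => unitary_ext_of_dense_iSup hd fun μ ψ hψ => ?_, hc,
    fun ψ φ => ⟨hgen ψ φ, fun h => ?_⟩⟩
  · change _ = (U s : H →L[ℂ] H) ((U t : H →L[ℂ] H) ψ)
    rw [hU t μ ψ hψ, map_smul, hU s μ ψ hψ, hU _ μ ψ hψ, smul_smul, add_mul, Circle.exp_add,
      Circle.coe_mul, mul_comm]
  · refine mem_graph_of_inner_eq hA fun ψ' φ' h' => ?_
    have h1 := h.inner ℂ (hgen ψ' φ' h')
    simp only [Unitary.inner_map_map, h0, inner_smul_left, inner_smul_right] at h1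
    have h2 := h1.unique (hasDerivAt_const _ _)
    have h3 : Complex.I * (inner ℂ ψ φ' - inner ℂ φ ψ') = 0 := by
      rw [← h2]; simp; ring
    exact (sub_eq_zero.1 ((mul_eq_zero.1 h3).resolve_left Complex.I_ne_zero)).symm

/-- A selfadjoint operator `A` with pure point spectrum generates a unitary group that is
recurrent in the strong topology: it factors through a compact torus, in which the inverse of
an element is a limit of its positive powers. -/
theorem exists_isExpGroup_recurrent (hA : IsSelfAdjoint A) (hpp : HasPurePointSpectrum A) :
    ∃ U, IsExpGroup A U ∧ ∀ t : ℝ,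
      U (-t) ∈ closure[strongTopology H] ((fun n : ℕ => U (n * t)) '' Set.Ioi 0) := by
  have hd := dense_iSup_eigenspace hA hpp
  choose D hD using exists_diagonal_unitary (isHilbertSum_eigenspace hA hd)
  have hDc := strongly_continuous_of_diagonal hd hD
  have hDc' : Continuous[_, strongTopology H] D :=
    continuous_induced_rng.2 (continuous_pi hDc)
  let χ : ℝ → ℝ → Circle := fun t μ => Circle.exp (t * μ)
  have hχ : Continuous χ := by fun_prop
  refine ⟨fun t => D (χ t), isExpGroup_of_eigenspace hA hd (fun t => hD (χ t))
    fun ψ => (hDc ψ).comp hχ, fun t => ?_⟩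
  have hmem : χ (-t) ∈ closure ((fun n : ℕ => χ (n * t)) '' Set.Ioi 0) := by
    have hcl := mapClusterPt_self_zpow_atTop_pow (χ t) (-1)
    have hneg : χ t ^ (-1 : ℤ) = χ (-t) := by
      ext μ; simp [χ, Circle.exp_neg]
    have hpow : ∀ n : ℕ, χ t ^ n = χ (n * t) := fun n => by
      ext μ; simp [χ, mul_assoc]
    simp only [hneg, hpow] at hcl
    exact mem_closure_iff_clusterPt.2 (ClusterPt.mono hcl
      (Filter.le_principal_iff.2 (Filter.image_mem_map (Filter.Ioi_mem_atTop 0))))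
  have h := @image_closure_subset_closure_image _ _ _ (strongTopology H) D _ hDc' _
    (Set.mem_image_of_mem D hmem)
  rwa [Set.image_image] at h

end

/-! ### Closed semigroups and the reachable set -/

section

/-- If the closure of a semigroup contains the inverses of the generators, it is a group. -/
theorem exists_subgroup_eq_closure {G : Type*} [Group G] [TopologicalSpace G]
    [IsTopologicalGroup G] {S : Set G} (hne : S.Nonempty)
    (hinv : ∀ s ∈ S, s⁻¹ ∈ closure (Subsemigroup.closure S : Set G)) :
    ∃ K : Subgroup G, (K : Set G) = closure (Subsemigroup.closure S : Set G) := by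
  let T : Subsemigroup G := (Subsemigroup.closure S).topologicalClosure
  have hT : (T : Set G) = closure (Subsemigroup.closure S : Set G) := rfl
  have hTinv : ∀ x ∈ T, x⁻¹ ∈ T := by
    have h1 : ∀ x ∈ Subsemigroup.closure S, x⁻¹ ∈ T := fun x hx => by
      induction hx using Subsemigroup.closure_induction with
      | mem x hx => exact hinv x hx
      | mul x y _ _ hx hy => rw [mul_inv_rev]; exact mul_mem hy hx
    exact closure_minimal h1 (isClosed_closure.preimage continuous_inv)
  obtain ⟨s, hs⟩ := hne
  have hsT : s ∈ T := subset_closure (Subsemigroup.subset_closure hs)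
  exact ⟨{ T with
    one_mem' := by simpa using T.mul_mem hsT (hTinv s hsT)
    inv_mem' := fun {x} hx => hTinv x hx }, hT⟩

variable {H : Type*} [NormedAddCommGroup H] [InnerProductSpace ℂ H] [CompleteSpace H]

theorem isTopologicalGroup_strongTopology :
    @IsTopologicalGroup (unitary (H →L[ℂ] H)) (strongTopology H) _ := by
  let _ : TopologicalSpace (unitary (H →L[ℂ] H)) := strongTopology H
  have happ : ∀ ψ : H, Continuous fun u : unitary (H →L[ℂ] H) => (u : H →L[ℂ] H) ψ := fun ψ =>
    (continuous_apply ψ).comp continuous_induced_dom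
  refine { continuous_mul := continuous_induced_rng.2 (continuous_pi fun ψ => ?_),
           continuous_inv := continuous_induced_rng.2 (continuous_pi fun ψ => ?_) }
  · exact continuous_unitary_apply (u := fun p : unitary (H →L[ℂ] H) × unitary (H →L[ℂ] H) => p.1)
      (fun ψ => (happ ψ).comp continuous_fst) ((happ ψ).comp continuous_snd)
  · have hcancel : ∀ u : unitary (H →L[ℂ] H),
        (u : H →L[ℂ] H) (((u⁻¹ : unitary (H →L[ℂ] H)) : H →L[ℂ] H) ψ) = ψ := fun u => by
      change ((u * u⁻¹ : unitary (H →L[ℂ] H)) : H →L[ℂ] H) ψ = ψ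
      rw [mul_inv_cancel]; rfl
    refine continuous_iff_continuousAt.2 fun u₀ => tendsto_iff_dist_tendsto_zero.2 ?_
    have h := (tendsto_const_nhds (x := ψ)).dist
      ((happ (((u₀⁻¹ : unitary (H →L[ℂ] H)) : H →L[ℂ] H) ψ)).tendsto u₀)
    rw [hcancel, dist_self] at h
    refine h.congr fun u => ?_
    simp only [Function.comp_def]
    rw [← unitary_dist_apply u (((u⁻¹ : unitary (H →L[ℂ] H)) : H →L[ℂ] H) ψ), hcancel]

theorem mem_closure_strongTopology {α : Type*} {l : Filter α} [l.NeBot]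
    {s : Set (unitary (H →L[ℂ] H))} {u : α → unitary (H →L[ℂ] H)} {v : unitary (H →L[ℂ] H)}
    (h : ∀ ψ : H, Filter.Tendsto (fun a => (u a : H →L[ℂ] H) ψ) l (𝓝 ((v : H →L[ℂ] H) ψ)))
    (hu : ∀ᶠ a in l, u a ∈ s) : v ∈ closure[strongTopology H] s := by
  let _ : TopologicalSpace (unitary (H →L[ℂ] H)) := strongTopology H
  refine mem_closure_of_tendsto (f := u) (b := l) ?_ hu
  rw [nhds_induced, Filter.tendsto_comap_iff]
  exact tendsto_pi_nhds.2 h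

end

section

variable {H : Type*} [NormedAddCommGroup H] [InnerProductSpace ℂ H]

theorem isClosed_vadd {A : H →ₗ.[ℂ] H} (hA : A.IsClosed) (V : H →L[ℂ] H) :
    ((V : H →ₗ[ℂ] H) +ᵥ A).IsClosed := by
  have h : (((V : H →ₗ[ℂ] H) +ᵥ A).graph : Set (H × H)) =
      (fun p : H × H => (p.1, p.2 - V p.1)) ⁻¹' (A.graph : Set (H × H)) := by
    ext ⟨ψ, φ⟩
    exact mem_graph_vadd_iff
  rw [LinearPMap.IsClosed, h]
  exact IsClosed.preimage (by fun_prop) hA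

theorem closure_eq_self {A : H →ₗ.[ℂ] H} (hA : A.IsClosed) : A.closure = A := by
  refine LinearPMap.eq_of_eq_graph ?_
  rw [← hA.isClosable.graph_closure_eq_closure_graph]
  exact IsClosed.submodule_topologicalClosure_eq hA

theorem add_mem_graph_add {A B : H →ₗ.[ℂ] H} {ψ φ χ : H} (hA : (ψ, φ) ∈ A.graph)
    (hB : (ψ, χ) ∈ B.graph) : (ψ, φ + χ) ∈ (A + B).graph := by
  obtain ⟨x, rfl, rfl⟩ := (LinearPMap.mem_graph_iff A).1 hA
  obtain ⟨y, hy, rfl⟩ := (LinearPMap.mem_graph_iff B).1 hB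
  have hxB : (x : H) ∈ B.domain := by
    have h := y.2
    rwa [hy] at h
  refine (LinearPMap.mem_graph_iff _).2 ⟨⟨x, x.2, hxB⟩, rfl, ?_⟩
  rw [LinearPMap.add_apply]
  congr 2
  exact Subtype.ext hy.symm

theorem smul_mem_graph_smul {A : H →ₗ.[ℂ] H} {ψ φ : H} (hA : (ψ, φ) ∈ A.graph) (c : ℂ) :
    (ψ, c • φ) ∈ (c • A).graph := by
  obtain ⟨x, rfl, rfl⟩ := (LinearPMap.mem_graph_iff A).1 hA
  exact (LinearPMap.mem_graph_iff _).2 ⟨x, rfl, rfl⟩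

/-- The sum of `H₀` and of everywhere defined operators has the domain of `H₀`. -/
theorem hamiltonian_eq_vadd {N : ℕ} {H₀ : H →ₗ.[ℂ] H} {Hc : Fin N → (H →ₗ.[ℂ] H)}
    {V : Fin N → H →L[ℂ] H} (hV : ∀ k ψ, (ψ, V k ψ) ∈ (Hc k).graph) (y : Fin N → ℝ) :
    hamiltonian H₀ Hc y =
      ((∑ j, ((y j : ℝ) : ℂ) • V j : H →L[ℂ] H) : H →ₗ[ℂ] H) +ᵥ H₀ := by
  have hsum : ∀ (s : Finset (Fin N)) (ψ : H),
      (ψ, (∑ j ∈ s, ((y j : ℝ) : ℂ) • V j) ψ) ∈ (∑ j ∈ s, ((y j : ℝ) : ℂ) • Hc j).graph := by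
    intro s ψ
    induction s using Finset.induction_on with
    | empty => exact (LinearPMap.mem_graph_iff _).2 ⟨⟨ψ, trivial⟩, rfl, rfl⟩
    | insert j s hj ih =>
      rw [Finset.sum_insert hj, Finset.sum_insert hj]
      exact add_mem_graph_add (smul_mem_graph_smul (hV j ψ) _) ih
  have hle : ((∑ j, ((y j : ℝ) : ℂ) • V j : H →L[ℂ] H) : H →ₗ[ℂ] H) +ᵥ H₀ ≤
      hamiltonian H₀ Hc y := by
    refine LinearPMap.le_of_le_graph ?_
    rintro ⟨ψ, φ⟩ h
    have h' := add_mem_graph_add (mem_graph_vadd_iff.1 h) (hsum Finset.univ ψ)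
    simp only [ContinuousLinearMap.coe_coe, sub_add_cancel] at h'
    exact h'
  exact (LinearPMap.eq_of_le_of_domain_eq hle (le_antisymm hle.1 inf_le_left)).symm

variable [CompleteSpace H]

/-- A bounded selfadjoint operator is everywhere defined: its graph is that of a symmetric
continuous linear map. -/
theorem exists_continuousLinearMap {A : H →ₗ.[ℂ] H} (hA : IsSelfAdjoint A)
    (hb : IsBoundedOperator A) :
    ∃ V : H →L[ℂ] H, (V : H →ₗ[ℂ] H).IsSymmetric ∧ ∀ ψ, (ψ, V ψ) ∈ A.graph := by
  obtain ⟨C, hC⟩ := hb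
  let f : A.domain →L[ℂ] H := A.toFun.mkContinuous C hC
  have hdense : DenseRange A.domain.subtypeL := by
    simpa [DenseRange] using hA.dense_domain
  have hind : IsUniformInducing A.domain.subtypeL := isUniformInducing_val _
  let V : H →L[ℂ] H := f.extend A.domain.subtypeL
  have hV : ∀ ψ, (ψ, V ψ) ∈ A.graph := by
    have hcl : IsClosed {ψ : H | (ψ, V ψ) ∈ A.graph} :=
      IsClosed.preimage (f := fun ψ : H => (ψ, V ψ)) (by fun_prop) hA.isClosed
    refine fun ψ => hdense.induction_on ψ hcl fun x => ?_
    have hx : V (A.domain.subtypeL x) = A x := f.extend_eq hdense hind x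
    rw [hx]
    exact A.mem_graph x
  exact ⟨V, fun ψ φ => inner_graph_symm hA (hV ψ) (hV φ), hV⟩

end

end QuantumControl

theorem proposition3 {H : Type*} [NormedAddCommGroup H] [InnerProductSpace ℂ H]
    [CompleteSpace H] [TopologicalSpace.SeparableSpace H] {N : ℕ}
    (H₀ : H →ₗ.[ℂ] H) (Hc : Fin N → (H →ₗ.[ℂ] H))
    (hH₀ : IsSelfAdjoint H₀) (hHc : ∀ k, IsSelfAdjoint (Hc k))
    (hpp : QuantumControl.HasPurePointSpectrum H₀)
    (hbdd : ∀ k, QuantumControl.IsBoundedOperator (Hc k)) :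
    QuantumControl.stronglyReachableSet H₀ Hc =
      (QuantumControl.dynamicalGroup H₀ Hc : Set (unitary (H →L[ℂ] H))) := by
  open QuantumControl in
  choose V hVsymm hVgraph using fun k => exists_continuousLinearMap (hHc k) (hbdd k)
  let P : (Fin N → ℝ) → H →L[ℂ] H := fun y => ∑ j, ((y j : ℝ) : ℂ) • V j
  have hPsymm : ∀ y, (P y : H →ₗ[ℂ] H).IsSymmetric := fun y φ ψ => by
    have h : ∀ j, inner ℂ (V j φ) ψ = inner ℂ φ (V j ψ) := fun j => hVsymm j φ ψ
    -- `Complex.coe_smul` would turn the complex scalars into real ones.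
    simp [P, sum_inner, inner_sum, inner_smul_left, inner_smul_right, h, -Complex.coe_smul]
  have hPneg : ∀ y, P (-y) = -P y := fun y => by simp [P]
  have hP0 : P 0 = 0 := by simp [P]
  have hham : ∀ y, (hamiltonian H₀ Hc y).closure = (P y : H →ₗ[ℂ] H) +ᵥ H₀ := fun y => by
    rw [hamiltonian_eq_vadd hVgraph]
    exact closure_eq_self (isClosed_vadd hH₀.isClosed _)
  obtain ⟨U, hU, hrec⟩ := exists_isExpGroup_recurrent hH₀ hpp
  have hU0 : IsExpGroup (hamiltonian H₀ Hc 0).closure U := by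
    rw [hham, hP0]
    simpa using hU
  let _ : TopologicalSpace (unitary (H →L[ℂ] H)) := strongTopology H
  have : IsTopologicalGroup (unitary (H →L[ℂ] H)) := isTopologicalGroup_strongTopology
  let R : Subsemigroup (unitary (H →L[ℂ] H)) := (algReachableSet H₀ Hc).topologicalClosure
  have hRcl : IsClosed (R : Set (unitary (H →L[ℂ] H))) := isClosed_closure
  have hevol : ∀ {u}, u ∈ evolutions H₀ Hc (Set.Ioi 0) → u ∈ R := fun hu =>
    subset_closure (Subsemigroup.subset_closure hu)
  have hUpos : ∀ {t : ℝ}, 0 < t → U t ∈ R := fun {t} ht => hevol ⟨0, U, hU0, t, ht, rfl⟩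
  have hUneg : ∀ {t : ℝ}, 0 < t → U (-t) ∈ R := fun {t} ht => by
    refine closure_minimal ?_ hRcl (hrec t)
    rintro _ ⟨n, hn, rfl⟩
    exact hUpos (mul_pos (Nat.cast_pos.2 hn) ht)
  have hpow : ∀ {u} (n : ℕ), u ∈ R → u ^ (n + 1) ∈ R := fun {u} n hu => by
    induction n with
    | zero => simpa using hu
    | succ n ih => rw [pow_succ]; exact mul_mem ih hu
  have hinv : ∀ u ∈ evolutions H₀ Hc (Set.Ioi 0), u⁻¹ ∈ R := by
    rintro _ ⟨y, W, hW, τ, hτ, rfl⟩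
    -- `-H(y) = -2 H₀ + H(-y)`: only the pure point part has to be run backwards.
    have hτ' : (0 : ℝ) < τ := hτ
    rw [← hW.map_neg]
    rw [hham] at hW
    obtain ⟨W', hW'⟩ := hU.exists_perturbation (hPsymm (-y))
    have hW'' : IsExpGroup (hamiltonian H₀ Hc (-y)).closure W' := by rwa [hham]
    rw [hPneg] at hW'
    refine hRcl.closure_subset (mem_closure_strongTopology
      (hU.tendsto_splitting hH₀.dense_domain hW hW' hτ'.le) ?_)
    -- The zeroth power is the identity, which is not yet known to be reachable.
    filter_upwards [Filter.eventually_gt_atTop 0] with n hn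
    obtain ⟨m, rfl⟩ := Nat.exists_eq_succ_of_ne_zero hn.ne'
    have hn' : 0 < τ / ((m.succ : ℕ) : ℝ) := div_pos hτ' (Nat.cast_pos.2 hn)
    exact hpow m (mul_mem (mul_mem (hUneg hn') (hUneg hn')) (hevol ⟨-y, W', hW'', _, hn', rfl⟩))
  obtain ⟨K, hK⟩ := exists_subgroup_eq_closure
    (S := evolutions H₀ Hc (Set.Ioi 0)) ⟨U 1, 0, U, hU0, 1, Set.mem_Ioi.2 one_pos, rfl⟩ hinv
  have hKR : ∀ {u}, u ∈ K ↔ u ∈ R := fun {u} => Set.ext_iff.1 hK u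
  refine Set.Subset.antisymm ?_ ?_
  · intro u hu
    refine Subgroup.mem_sInf.2 fun L hL => closure_minimal ?_ hL.1 hu
    refine (Subsemigroup.closure_le (S := L.toSubmonoid.toSubsemigroup)).2 ?_
    rintro _ ⟨y, W, hW, τ, -, rfl⟩
    exact hL.2 ⟨y, W, hW, τ, trivial, rfl⟩
  · intro u hu
    refine hKR.1 (Subgroup.mem_sInf.1 hu K ⟨?_, ?_⟩)
    · rw [hK]; exact isClosed_closure
    rintro _ ⟨y, W, hW, τ, -, rfl⟩
    rcases lt_trichotomy τ 0 with hτ | rfl | hτ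
    · rw [SetLike.mem_coe, ← inv_mem_iff, ← hW.map_neg]
      exact hKR.2 (hevol ⟨y, W, hW, -τ, neg_pos.2 hτ, rfl⟩)
    · rw [hW.map_zero]; exact one_mem K
    · exact hKR.2 (hevol ⟨y, W, hW, τ, hτ, rfl⟩)
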